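/- Let $\mathcal X,\mathcal Y$ be finite sets and let $W=\{W(x,y|x',y')\}$ be an irreducible transition matrix on $\mathcal X\times\mathcal Y$ (so $W(x,y|x',y')\ge 0$ and $\sum_{x,y}W(x,y|x',y')=1$ for all $x',y'$). Suppose that $W$ is non-hidden with respect to $\mathcal Y$: the sum $W(y|y'):=\sum_{x}W(x,y|x',y')$ does not depend on $x'$, for all $y,y'\in\mathcal Y$. For $\theta>-1$ let $\lambda_\theta$ be the Perron–Frobenius eigenvalue (spectral radius) of the matrix $W(x,y|x',y')^{1+\theta}\,W(y|y')^{-\theta}$ (an entry being $0$ where $W(x,y|x',y')=0$), and for $\theta\neq 0$ put $$H^{\downarrow,W}_{1+\theta}(X|Y):=-\frac1\theta\log\lambda_\theta .$$ Then the limits $$H^W(X|Y):=\lim_{\theta\to0}H^{\downarrow,W}_{1+\theta}(X|Y),\qquad \mathsf V^W(X|Y):=\lim_{\theta\to0}\frac{2\left[H^W(X|Y)-H^{\downarrow,W}_{1+\theta}(X|Y)\right]}{\theta}$$ exist as real numbers, and for every initial distribution $P_{X_1Y_1}$ on $\mathcal X\times\mathcal Y$ the Markov chain $(X_i,Y_i)_{i\ge1}$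 with initial distribution $P_{X_1Y_1}$ and transition matrix $W$ satisfies $$\lim_{n\to\infty}\frac1n\,\mathsf V(X^n|Y^n)=\mathsf V^W(X|Y),$$ where $X^n=(X_1,\dots,X_n)$, $Y^n=(Y_1,\dots,Y_n)$ and $\mathsf V(X^n|Y^n):=\mathrm{Var}\left[\log\frac{1}{P_{X^n|Y^n}(X^n|Y^n)}\right]$. -/

import Mathlib

noncomputable section

namespace MarkovVariance

/-- The conditional probability `P_{U|V}(u|v) = μ(U = u | V = v)`. -/
def condProb {Ω A B : Type*} [MeasurableSpace Ω] (μ : MeasureTheory.Measure Ω)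
    (U : Ω → A) (V : Ω → B) (u : A) (v : B) : ℝ :=
  (ProbabilityTheory.cond μ (V ⁻¹' {v})).real (U ⁻¹' {u})

/-- `V(U|V) = Var[log (1 / P_{U|V}(U|V))]`. -/
def condVar {Ω A B : Type*} [MeasurableSpace Ω] (μ : MeasureTheory.Measure Ω)
    (U : Ω → A) (V : Ω → B) : ℝ :=
  ProbabilityTheory.variance
    (fun ω => Real.log (1 / condProb μ U V (U ω) (V ω))) μ

/-- The first `n` variables of a process, as one random vector. -/
def firstVars {Ω A : Type*} (X : ℕ → Ω → A) (n : ℕ) : Ω → (Fin n → A) :=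
  fun ω i => X i ω

/-- `Z` is a Markov chain with initial distribution `P` and transition matrix `W`, where `W s s'`
is the probability `W(s|s')` of moving from `s'` to `s`. The chain starts at time `0`. -/
structure IsMarkovChain {Ω S : Type*} [MeasurableSpace Ω] [MeasurableSpace S]
    (μ : MeasureTheory.Measure Ω) (P : S → ℝ) (W : Matrix S S ℝ) (Z : ℕ → Ω → S) : Prop where
  measurable : ∀ i, Measurable (Z i)
  path_prob : ∀ (n : ℕ) (z : Fin (n + 1) → S),
    μ.real {ω | ∀ i : Fin (n + 1), Z i ω = z i} =
      P (z 0) * ∏ i : Fin n, W (z i.succ) (z i.castSucc)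

/-- `W` is non-hidden with respect to the second component, and `WY` is the resulting transition
matrix: `∑ x, W(x,y|x',y') = WY(y|y')` for all `x'`, `y`, `y'`. -/
def IsNonHidden {X Y : Type*} [Fintype X]
    (W : Matrix (X × Y) (X × Y) ℝ) (WY : Matrix Y Y ℝ) : Prop :=
  ∀ (x' : X) (y y' : Y), ∑ x, W (x, y) (x', y') = WY y y'

/-- The tilted matrix `W(x,y|x',y')^(1+θ) * WY(y|y')^(-θ)`. -/
def tilted {X Y : Type*} (W : Matrix (X × Y) (X × Y) ℝ) (WY : Matrix Y Y ℝ) (θ : ℝ) :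
    Matrix (X × Y) (X × Y) ℝ :=
  Matrix.of fun a b => W a b ^ (1 + θ) * WY a.2 b.2 ^ (-θ)

/-- The Perron–Frobenius eigenvalue of an irreducible nonnegative matrix: its spectral radius,
i.e. the largest modulus of a complex eigenvalue. -/
def perronFrobenius {S : Type*} [Fintype S] [DecidableEq S] (A : Matrix S S ℝ) : ℝ :=
  (spectralRadius ℂ (A.map (Complex.ofReal : ℝ → ℂ))).toReal

variable {X Y : Type*} [Fintype X] [DecidableEq X] [Fintype Y] [DecidableEq Y]

/-- The lower conditional Rényi entropy of order `1 + θ` for `W`, where `θ > -1`, `θ ≠ 0`. -/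
def lowerRenyi (W : Matrix (X × Y) (X × Y) ℝ) (WY : Matrix Y Y ℝ) (θ : ℝ) : ℝ :=
  -(1 / θ) * Real.log (perronFrobenius (tilted W WY θ))

/-- The conditional entropy `H^W(X|Y)`, the limit of `lowerRenyi` as `θ → 0`, `θ ≠ 0`. -/
def condEntropyW (W : Matrix (X × Y) (X × Y) ℝ) (WY : Matrix Y Y ℝ) : ℝ :=
  Filter.limUnder (nhdsWithin (0 : ℝ) {0}ᶜ) (lowerRenyi W WY)

/-- The quotient `2 [H^W(X|Y) - H_{1+θ}^{↓,W}(X|Y)] / θ`. -/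
def varQuotient (W : Matrix (X × Y) (X × Y) ℝ) (WY : Matrix Y Y ℝ) (θ : ℝ) : ℝ :=
  2 * (condEntropyW W WY - lowerRenyi W WY θ) / θ

/-- `V^W(X|Y)`, the limit of `varQuotient` as `θ → 0`, `θ ≠ 0`. -/
def varianceW (W : Matrix (X × Y) (X × Y) ℝ) (WY : Matrix Y Y ℝ) : ℝ :=
  Filter.limUnder (nhdsWithin (0 : ℝ) {0}ᶜ) (varQuotient W WY)

end MarkovVariance

end

/-! Both sides are computed from the same two Poisson equations. With `u = log W - log WY`, the
tilted matrix is `W exp(θu)`, which at `θ = 0` is stochastic with eigenvalue `1` and left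
eigenvector `1`. Seeking an eigenvalue `1 + αθ + cθ²` with left eigenvector `1 + θh + θ²k` and
comparing coefficients gives two Poisson equations for `W`, solvable by irreducibility
(`exists_poisson`). The truncated eigenvector is positive for small `θ` and satisfies the eigenvalue
equation up to `o(θ²)`, so Collatz–Wielandt bounds give `λ_θ = 1 + αθ + cθ² + o(θ²)` without
analytic perturbation theory. Taking logarithms, `H^W = -α` and `V^W = 2c - α²`.

On the probabilistic side, non-hiddenness makes the law of `Y^n` a product of `WY` factors, so the
conditional log-likelihood is an initial term plus a sum of `u` over the transitions
(`ae_log_condProb`). The first Poisson equation writes `u - α` as a martingale difference plus a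
coboundary in `h`; the second shows that its conditional second moment is `2c - α²` plus a
coboundary in `2k - h²`. The martingale variance is therefore `m(2c - α²) + O(1)`, and the boundary
terms, being bounded, change it by `O(√m)`. Neither stationarity nor aperiodicity is needed. -/

namespace MarkovVariance

open Matrix

/-! ### The Poisson equation of an irreducible stochastic matrix -/

section Poisson

variable {S : Type*} [Fintype S] [DecidableEq S]

/-- A function which is harmonic for an irreducible stochastic matrix is constant. -/
theorem eq_of_vecMul_eq_self {W : Matrix S S ℝ} (hW : W ∈ colStochastic ℝ S)
    (hirr : W.IsIrreducible) {h : S → ℝ} (hh : h ᵥ* W = h) (a b : S) : h a = h b := by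
  classical
  have : Nonempty S := ⟨a⟩
  obtain ⟨m, hm⟩ := Finite.exists_max h
  have key : ∀ s, h s = h m := by
    intro s
    obtain ⟨k, -, hk⟩ := (isIrreducible_iff_exists_pow_pos hirr.nonneg).1 hirr s m
    have hWk : W ^ k ∈ colStochastic ℝ S := pow_mem hW k
    have hhk : ∀ j : ℕ, h ᵥ* W ^ j = h := by
      intro j
      induction j with
      | zero => simp
      | succ j ih => rw [pow_succ, ← vecMul_vecMul, ih, hh]
    -- Maximum principle: `h m` is an average of values at most `h m`, and `s` carries positive
    -- weight in it.
    have hsum : ∑ t, (h m - h t) * (W ^ k) t m = 0 := by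
      have h1 : ∑ t, h t * (W ^ k) t m = h m := congrFun (hhk k) m
      simp_rw [sub_mul, Finset.sum_sub_distrib, ← Finset.mul_sum,
        sum_col_of_mem_colStochastic hWk, h1]
      ring
    have h0 := (Finset.sum_eq_zero_iff_of_nonneg (fun t _ =>
      mul_nonneg (sub_nonneg.2 (hm t)) (nonneg_of_mem_colStochastic hWk))).1 hsum s
        (Finset.mem_univ s)
    rcases mul_eq_zero.1 h0 with h0 | h0
    · linarith
    · exact absurd h0 hk.ne'
  rw [key a, key b]

/-- A coboundary of a stochastic matrix which is constant vanishes. -/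
theorem eq_zero_of_sub_vecMul_eq_const [Nonempty S] {W : Matrix S S ℝ}
    (hW : W ∈ colStochastic ℝ S) {h : S → ℝ} {c : ℝ} (hh : ∀ b, h b - (h ᵥ* W) b = c) :
    c = 0 := by
  obtain ⟨m, hm⟩ := Finite.exists_max h
  obtain ⟨l, hl⟩ := Finite.exists_min h
  have eq : ∀ b, c = ∑ t, (h b - h t) * W t b := by
    intro b
    rw [← hh b]
    simp_rw [sub_mul, Finset.sum_sub_distrib, ← Finset.mul_sum, sum_col_of_mem_colStochastic hW]
    simp [vecMul, dotProduct]
  apply le_antisymm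
  · rw [eq l]
    exact Finset.sum_nonpos fun t _ =>
      mul_nonpos_of_nonpos_of_nonneg (sub_nonpos.2 (hl t)) (nonneg_of_mem_colStochastic hW)
  · rw [eq m]
    exact Finset.sum_nonneg fun t _ =>
      mul_nonneg (sub_nonneg.2 (hm t)) (nonneg_of_mem_colStochastic hW)

/-- The Poisson equation of an irreducible stochastic matrix is solvable up to a constant. -/
theorem exists_poisson [Nonempty S] {W : Matrix S S ℝ} (hW : W ∈ colStochastic ℝ S)
    (hirr : W.IsIrreducible) (g : S → ℝ) :
    ∃ (c : ℝ) (h : S → ℝ), ∀ b, g b = c + h b - (h ᵥ* W) b := by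
  obtain ⟨s⟩ := ‹Nonempty S›
  have : Nonempty S := ⟨s⟩
  -- Adding evaluation at `s` removes the constants from the kernel of `id - W`; the operator
  -- becomes injective, hence surjective, and the added term `h s` serves as `c`.
  let L : (S → ℝ) →ₗ[ℝ] (S → ℝ) :=
    LinearMap.id - W.vecMulLinear + LinearMap.pi fun _ => LinearMap.proj s
  have hL : ∀ h b, L h b = h b - (h ᵥ* W) b + h s := fun h b => rfl
  have hinj : Function.Injective L := by
    rw [injective_iff_map_eq_zero]
    intro h h0
    have h1 : ∀ b, h b - (h ᵥ* W) b = -h s := by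
      intro b
      have := congrFun h0 b
      rw [hL] at this
      simp only [Pi.zero_apply] at this
      linarith
    have h2 : h s = 0 := by
      have := eq_zero_of_sub_vecMul_eq_const hW h1
      linarith
    have h3 : h ᵥ* W = h := by
      funext b
      have := h1 b
      rw [h2] at this
      linarith
    funext b
    rw [eq_of_vecMul_eq_self hW hirr h3 b s, h2]
    rfl
  obtain ⟨h, hh⟩ := LinearMap.injective_iff_surjective.1 hinj g
  refine ⟨h s, h, fun b => ?_⟩
  rw [← hh, hL]
  ring

end Poisson

/-! ### Collatz–Wielandt bounds for the spectral radius -/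

section CollatzWielandt

variable {S : Type*} [Fintype S] [DecidableEq S]

/-- An entrywise bound `v A ≤ c v` with `v > 0` bounds every eigenvalue by `c`. -/
theorem spectralRadius_le_of_vecMul_le {A : Matrix S S ℝ} (hA : ∀ a b, 0 ≤ A a b)
    {v : S → ℝ} (hv : ∀ b, 0 < v b) {c : ℝ} (h : ∀ b, (v ᵥ* A) b ≤ c * v b) :
    spectralRadius ℂ (A.map (Complex.ofReal : ℝ → ℂ)) ≤ ENNReal.ofReal c := by
  refine iSup₂_le fun z hz => ?_
  rw [← spectrum_toLin', ← Module.End.hasEigenvalue_iff_mem_spectrum] at hz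
  obtain ⟨w, hw⟩ := hz.exists_hasEigenvector
  have hw0 : w ≠ 0 := hw.2
  have hAw : ∀ a, ∑ b, (A a b : ℂ) * w b = z * w a := by
    intro a
    have := congrFun hw.apply_eq_smul a
    simpa [toLin'_apply, mulVec, dotProduct] using this
  obtain ⟨s, hs⟩ := Function.ne_iff.1 hw0
  have hpos : 0 < ∑ b, v b * ‖w b‖ :=
    Finset.sum_pos' (fun b _ => mul_nonneg (hv b).le (norm_nonneg _))
      ⟨s, Finset.mem_univ s, mul_pos (hv s) (norm_pos_iff.2 hs)⟩
  -- Pair `v` with the entrywise modulus of the eigenvector; the pairing is positive and can be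
  -- cancelled.
  have hle : ‖z‖ * ∑ b, v b * ‖w b‖ ≤ c * ∑ b, v b * ‖w b‖ := by
    calc ‖z‖ * ∑ a, v a * ‖w a‖ = ∑ a, v a * ‖∑ b, (A a b : ℂ) * w b‖ := by
          rw [Finset.mul_sum]
          refine Finset.sum_congr rfl fun a _ => ?_
          rw [hAw, norm_mul]
          ring
      _ ≤ ∑ a, v a * ∑ b, A a b * ‖w b‖ := by
          refine Finset.sum_le_sum fun a _ => mul_le_mul_of_nonneg_left ?_ (hv a).le
          refine (norm_sum_le _ _).trans_eq (Finset.sum_congr rfl fun b _ => ?_)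
          rw [norm_mul, Complex.norm_real, Real.norm_of_nonneg (hA a b)]
      _ = ∑ b, (v ᵥ* A) b * ‖w b‖ := by
          simp_rw [vecMul, dotProduct, Finset.mul_sum, Finset.sum_mul]
          rw [Finset.sum_comm]
          exact Finset.sum_congr rfl fun b _ => Finset.sum_congr rfl fun a _ => by ring
      _ ≤ ∑ b, c * v b * ‖w b‖ :=
          Finset.sum_le_sum fun b _ => mul_le_mul_of_nonneg_right (h b) (norm_nonneg _)
      _ = c * ∑ b, v b * ‖w b‖ := by
          rw [Finset.mul_sum]
          exact Finset.sum_congr rfl fun b _ => by ring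
  have hzc : ‖z‖ ≤ c := le_of_mul_le_mul_right hle hpos
  rw [← enorm_eq_nnnorm, ← ofReal_norm]
  exact ENNReal.ofReal_le_ofReal hzc

theorem pow_mul_le_vecMul_pow {A : Matrix S S ℝ} (hA : ∀ a b, 0 ≤ A a b) {v : S → ℝ} {c : ℝ}
    (hc : 0 ≤ c) (h : ∀ b, c * v b ≤ (v ᵥ* A) b) (n : ℕ) (b : S) :
    c ^ n * v b ≤ (v ᵥ* A ^ n) b := by
  induction n generalizing b with
  | zero => simp
  | succ n ih =>
    rw [pow_succ A, ← vecMul_vecMul]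
    calc c ^ (n + 1) * v b = c ^ n * (c * v b) := by ring
      _ ≤ c ^ n * (v ᵥ* A) b := mul_le_mul_of_nonneg_left (h b) (pow_nonneg hc n)
      _ = ∑ a, (c ^ n * v a) * A a b := by
          simp_rw [vecMul, dotProduct, Finset.mul_sum, mul_assoc]
      _ ≤ ((v ᵥ* A ^ n) ᵥ* A) b :=
          Finset.sum_le_sum fun a _ => mul_le_mul_of_nonneg_right (ih a) (hA a b)

-- A Banach algebra norm is needed for Gelfand's formula.
attribute [local instance] Matrix.linftyOpNormedRing Matrix.linftyOpNormedAlgebra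

/-- An entrywise bound `c v ≤ v A` with `v > 0` bounds the spectral radius from below. -/
theorem le_spectralRadius_of_le_vecMul [Nonempty S] {A : Matrix S S ℝ}
    (hA : ∀ a b, 0 ≤ A a b) {v : S → ℝ} (hv : ∀ b, 0 < v b) {c : ℝ} (hc : 0 ≤ c)
    (h : ∀ b, c * v b ≤ (v ᵥ* A) b) :
    ENNReal.ofReal c ≤ spectralRadius ℂ (A.map (Complex.ofReal : ℝ → ℂ)) := by
  obtain ⟨s⟩ := ‹Nonempty S›
  set B : Matrix S S ℂ := A.map (Complex.ofReal : ℝ → ℂ) with hB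
  have hBpow : ∀ n, B ^ n = (A ^ n).map (Complex.ofReal : ℝ → ℂ) := fun n =>
    (map_pow (Complex.ofRealHom.mapMatrix) A n).symm
  have hentry : ∀ n a b, (A ^ n) a b ≤ ‖B ^ n‖ := by
    intro n a b
    have h1 : ‖(B ^ n) a b‖ ≤ ‖B ^ n‖ := by
      rw [linfty_opNorm_def]
      have h2 : ‖(B ^ n) a b‖₊ ≤ ∑ j, ‖(B ^ n) a j‖₊ :=
        Finset.single_le_sum (f := fun j => ‖(B ^ n) a j‖₊) (fun _ _ => zero_le)
          (Finset.mem_univ b)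
      exact_mod_cast h2.trans
        (Finset.le_sup (f := fun i => ∑ j, ‖(B ^ n) i j‖₊) (Finset.mem_univ a))
    refine le_trans ?_ h1
    rw [hBpow]
    simpa using le_abs_self ((A ^ n) a b)
  have hV : 0 < ∑ a, v a := Finset.sum_pos (fun a _ => hv a) ⟨s, Finset.mem_univ s⟩
  -- From `c^n v_s ≤ ∑ v_a (A^n)_{as} ≤ (∑ v_a) ‖B^n‖`; the factor `C` disappears under the `n`-th
  -- root.
  set C : ℝ := v s / ∑ a, v a with hC
  have hCpos : 0 < C := div_pos (hv s) hV
  have hnorm : ∀ n, C * c ^ n ≤ ‖B ^ n‖ := by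
    intro n
    have h1 : c ^ n * v s ≤ (∑ a, v a) * ‖B ^ n‖ := by
      refine (pow_mul_le_vecMul_pow hA hc h n s).trans ?_
      rw [Finset.sum_mul]
      exact Finset.sum_le_sum fun a _ => mul_le_mul_of_nonneg_left (hentry n a s) (hv a).le
    rw [hC, div_mul_eq_mul_div, div_le_iff₀ hV]
    linarith
  have hlim : Filter.Tendsto (fun n : ℕ => ENNReal.ofReal (C ^ (1 / (n : ℝ)) * c)) Filter.atTop
      (nhds (ENNReal.ofReal c)) := by
    have h1 : Filter.Tendsto (fun n : ℕ => C ^ (1 / (n : ℝ))) Filter.atTop (nhds (C ^ (0 : ℝ))) :=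
      (Real.continuousAt_const_rpow hCpos.ne').tendsto.comp tendsto_one_div_atTop_nhds_zero_nat
    rw [Real.rpow_zero] at h1
    have h2 := ENNReal.tendsto_ofReal (h1.mul_const c)
    rwa [one_mul] at h2
  refine le_of_tendsto_of_tendsto hlim
    (spectrum.pow_norm_pow_one_div_tendsto_nhds_spectralRadius B) ?_
  filter_upwards [Filter.eventually_ge_atTop 1] with n hn
  refine ENNReal.ofReal_le_ofReal ?_
  have hn0 : n ≠ 0 := by omega
  calc C ^ (1 / (n : ℝ)) * c = (C * c ^ n) ^ (1 / (n : ℝ)) := by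
        rw [Real.mul_rpow hCpos.le (pow_nonneg hc n), one_div, Real.pow_rpow_inv_natCast hc hn0]
    _ ≤ ‖B ^ n‖ ^ (1 / (n : ℝ)) :=
        Real.rpow_le_rpow (mul_nonneg hCpos.le (pow_nonneg hc n)) (hnorm n) (by positivity)

/-- Two-sided Collatz–Wielandt bound for the Perron–Frobenius eigenvalue. -/
theorem abs_perronFrobenius_sub_le [Nonempty S] {A : Matrix S S ℝ}
    (hA : ∀ a b, 0 ≤ A a b) {v : S → ℝ} (hv : ∀ b, 0 < v b) {r ε : ℝ} (hr : ε ≤ r) (hε : 0 ≤ ε)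
    (h : ∀ b, |(v ᵥ* A) b - r * v b| ≤ ε * v b) : |perronFrobenius A - r| ≤ ε := by
  have hup := spectralRadius_le_of_vecMul_le hA hv (c := r + ε) fun b => by
    linarith [(abs_le.1 (h b)).2]
  have hlo := le_spectralRadius_of_le_vecMul hA hv (c := r - ε) (sub_nonneg.2 hr) fun b => by
    linarith [(abs_le.1 (h b)).1]
  have htop : spectralRadius ℂ (A.map (Complex.ofReal : ℝ → ℂ)) ≠ ⊤ :=
    ne_top_of_le_ne_top ENNReal.ofReal_ne_top hup
  rw [abs_le]
  constructor
  · have := (ENNReal.ofReal_le_iff_le_toReal htop).1 hlo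
    rw [perronFrobenius]
    linarith
  · have := ENNReal.toReal_le_of_le_ofReal (by linarith) hup
    rw [perronFrobenius]
    linarith

end CollatzWielandt

/-! ### Second-order expansion of the Perron–Frobenius eigenvalue -/

section Expansion

open Asymptotics Filter Topology

theorem isLittleO_sq_mul {g : ℝ → ℝ} (hg : Tendsto g (𝓝 0) (𝓝 0)) :
    (fun θ : ℝ => θ ^ 2 * g θ) =o[𝓝 0] fun θ => θ ^ 2 := by
  have := (isBigO_refl (fun θ : ℝ => θ ^ 2) (𝓝 0)).mul_isLittleO ((isLittleO_one_iff ℝ).2 hg)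
  simpa using this

theorem exp_mul_sub_isLittleO_sq (u : ℝ) :
    (fun θ : ℝ => Real.exp (θ * u) - (1 + θ * u + (θ * u) ^ 2 / 2)) =o[𝓝 0] fun θ => θ ^ 2 := by
  have hlim : Tendsto (fun θ : ℝ => θ * u) (𝓝 0) (𝓝 0) := by
    have : Continuous fun θ : ℝ => θ * u := by fun_prop
    simpa using this.tendsto 0
  have h1 := (Real.exp_sub_sum_range_succ_isLittleO_pow 2).comp_tendsto hlim
  have h2 : (fun θ : ℝ => (θ * u) ^ 2) =O[𝓝 0] fun θ => θ ^ 2 := by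
    simp_rw [mul_pow, mul_comm _ (u ^ 2)]
    exact isBigO_const_mul_self _ _ _
  refine (h1.congr_left fun θ => ?_).trans_isBigO h2
  simp [Finset.sum_range_succ]

theorem log_one_add_sub_isLittleO_sq :
    (fun x : ℝ => Real.log (1 + x) - (x - x ^ 2 / 2)) =o[𝓝 0] fun x => x ^ 2 := by
  have hO : (fun x : ℝ => Real.log (1 + x) - (x - x ^ 2 / 2)) =O[𝓝 0] fun x => x ^ 3 := by
    refine IsBigO.of_bound 2 ?_
    filter_upwards [Metric.ball_mem_nhds (0 : ℝ) (by norm_num : (0 : ℝ) < 1 / 2)] with x hx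
    have hx' : |x| < 1 / 2 := by simpa using hx
    have h := Real.abs_log_sub_add_sum_range_le (x := -x) (by rw [abs_neg]; linarith) 2
    rw [abs_neg, sub_neg_eq_add] at h
    have e : ∑ i ∈ Finset.range 2, (-x) ^ (i + 1) / ((i : ℝ) + 1) + Real.log (1 + x)
        = Real.log (1 + x) - (x - x ^ 2 / 2) := by
      simp [Finset.sum_range_succ]
      ring
    rw [e] at h
    rw [Real.norm_eq_abs, norm_pow, Real.norm_eq_abs]
    refine h.trans ?_
    rw [div_le_iff₀ (by linarith)]
    have : 0 ≤ |x| ^ 3 := by positivity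
    change |x| ^ 3 ≤ _
    nlinarith [mul_nonneg this (sub_nonneg.2 hx'.le)]
  exact hO.trans_isLittleO (isLittleO_pow_pow (by norm_num))

theorem log_sub_isLittleO_sq {ρ : ℝ → ℝ} {α c : ℝ}
    (hρ : (fun θ => ρ θ - (1 + α * θ + c * θ ^ 2)) =o[𝓝 0] fun θ : ℝ => θ ^ 2) :
    (fun θ => Real.log (ρ θ) - (α * θ + (c - α ^ 2 / 2) * θ ^ 2)) =o[𝓝 0]
      fun θ : ℝ => θ ^ 2 := by
  have hsq : (fun θ : ℝ => θ ^ 2) =o[𝓝 0] fun θ : ℝ => θ := by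
    simpa using isLittleO_pow_pow (𝕜 := ℝ) (m := 1) (n := 2) (by norm_num)
  have hid : Tendsto (fun θ : ℝ => θ) (𝓝 0) (𝓝 0) := tendsto_id
  have hx1 : (fun θ => ρ θ - 1 - α * θ) =o[𝓝 0] fun θ : ℝ => θ := by
    have h1 : (fun θ : ℝ => c * θ ^ 2) =o[𝓝 0] fun θ : ℝ => θ := hsq.const_mul_left c
    refine ((hρ.trans hsq).add h1).congr_left fun θ => by ring
  have hα : ∀ β : ℝ, (fun θ : ℝ => β * θ) =O[𝓝 0] fun θ : ℝ => θ := fun β =>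
    isBigO_const_mul_self _ _ _
  have hxO : (fun θ => ρ θ - 1) =O[𝓝 0] fun θ : ℝ => θ :=
    (hx1.isBigO.add (hα α)).congr_left fun θ => by ring
  have hx0 : Tendsto (fun θ => ρ θ - 1) (𝓝 0) (𝓝 0) := hxO.trans_tendsto hid
  have hlog : (fun θ => Real.log (ρ θ) - ((ρ θ - 1) - (ρ θ - 1) ^ 2 / 2)) =o[𝓝 0]
      fun θ : ℝ => θ ^ 2 := by
    have := (log_one_add_sub_isLittleO_sq.comp_tendsto hx0).trans_isBigO (hxO.pow 2)
    refine this.congr_left fun θ => ?_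
    simp
  -- This is `(ρ - 1)² - α²θ²`, factored as `o(θ)` times `O(θ)`.
  have hprod : (fun θ => (ρ θ - 1 - α * θ) * (ρ θ - 1 + α * θ)) =o[𝓝 0] fun θ : ℝ => θ ^ 2 := by
    simpa [sq] using hx1.mul_isBigO (hxO.add (hα α))
  refine ((hlog.add hρ).sub (hprod.const_mul_left (1 / 2))).congr_left fun θ => ?_
  ring

variable {S : Type*} [Fintype S] [DecidableEq S]

/-- `α` and `c` are the first two Taylor coefficients of the Perron–Frobenius eigenvalue of the
tilted matrices `W a b * exp (θ * u a b)`, and `h`, `k` those of a left eigenvector. -/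
structure IsEigenExpansion (W : Matrix S S ℝ) (u : S → S → ℝ) (α c : ℝ) (h k : S → ℝ) :
    Prop where
  first : ∀ b, ∑ a, W a b * u a b = α + h b - (h ᵥ* W) b
  second : ∀ b, ∑ a, W a b * (u a b ^ 2 / 2 + u a b * h a) = c + α * h b + k b - (k ᵥ* W) b

/-- The order-one equation fixes `α` and `h`; these enter the source term of the order-two equation,
a Poisson equation for `c` and `k`. -/
theorem exists_isEigenExpansion [Nonempty S] {W : Matrix S S ℝ} (hW : W ∈ colStochastic ℝ S)
    (hirr : W.IsIrreducible) (u : S → S → ℝ) :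
    ∃ α c h k, IsEigenExpansion W u α c h k := by
  obtain ⟨α, h, hh⟩ := exists_poisson hW hirr fun b => ∑ a, W a b * u a b
  obtain ⟨c, k, hk⟩ := exists_poisson hW hirr fun b =>
    ∑ a, W a b * (u a b ^ 2 / 2 + u a b * h a) - α * h b
  exact ⟨α, c, h, k, hh, fun b => by linarith [hk b]⟩

theorem IsEigenExpansion.vecMul_sub_isLittleO {W : Matrix S S ℝ} (hW : W ∈ colStochastic ℝ S)
    {u : S → S → ℝ} {α c : ℝ} {h k : S → ℝ} (E : IsEigenExpansion W u α c h k) (b : S) :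
    (fun θ : ℝ => ((fun a => 1 + θ * h a + θ ^ 2 * k a) ᵥ*
        Matrix.of fun a b => W a b * Real.exp (θ * u a b)) b
      - (1 + α * θ + c * θ ^ 2) * (1 + θ * h b + θ ^ 2 * k b)) =o[𝓝 0] fun θ => θ ^ 2 := by
  have hterm : ∀ a, (fun θ : ℝ => (1 + θ * h a + θ ^ 2 * k a) * (W a b * Real.exp (θ * u a b))
      - W a b * (1 + θ * (u a b + h a) + θ ^ 2 * (u a b ^ 2 / 2 + u a b * h a + k a))) =o[𝓝 0]
      fun θ => θ ^ 2 := by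
    intro a
    have h1 : (fun θ : ℝ => (1 + θ * h a + θ ^ 2 * k a) * W a b) =O[𝓝 0] fun _ => (1 : ℝ) := by
      have : Continuous fun θ : ℝ => (1 + θ * h a + θ ^ 2 * k a) * W a b := by fun_prop
      exact (this.tendsto 0).isBigO_one ℝ
    have h2 := h1.mul_isLittleO (exp_mul_sub_isLittleO_sq (u a b))
    simp only [one_mul] at h2
    have h3 : (fun θ : ℝ => θ ^ 2 * (W a b * θ * (h a * u a b ^ 2 / 2 + k a * u a b
        + θ * (k a * u a b ^ 2 / 2)))) =o[𝓝 0] fun θ => θ ^ 2 := by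
      refine isLittleO_sq_mul ?_
      have : Continuous fun θ : ℝ => W a b * θ * (h a * u a b ^ 2 / 2 + k a * u a b
        + θ * (k a * u a b ^ 2 / 2)) := by fun_prop
      simpa using this.tendsto 0
    refine (h2.add h3).congr_left fun θ => ?_
    ring
  have hsum := IsLittleO.fun_sum (s := Finset.univ) fun a _ => hterm a
  -- The terms of order three and four in the product of eigenvalue and eigenvector polynomials.
  have hrem : (fun θ : ℝ => θ ^ 2 * (-θ * (α * k b + c * h b + θ * (c * k b)))) =o[𝓝 0]
      fun θ => θ ^ 2 := by
    refine isLittleO_sq_mul ?_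
    have : Continuous fun θ : ℝ => -θ * (α * k b + c * h b + θ * (c * k b)) := by fun_prop
    simpa using this.tendsto 0
  refine (hsum.add hrem).congr_left fun θ => ?_
  have h0 : ∑ a, W a b = 1 := sum_col_of_mem_colStochastic hW b
  have h1 := E.first b
  have h2 := E.second b
  simp only [vecMul, dotProduct, of_apply] at h1 h2 ⊢
  have hmain : ∑ a, W a b * (1 + θ * (u a b + h a)
      + θ ^ 2 * (u a b ^ 2 / 2 + u a b * h a + k a))
      = 1 + θ * (α + h b) + θ ^ 2 * (c + α * h b + k b) := by
    calc _ = ∑ a, W a b + θ * (∑ a, W a b * u a b + ∑ a, h a * W a b)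
          + θ ^ 2 * (∑ a, W a b * (u a b ^ 2 / 2 + u a b * h a) + ∑ a, k a * W a b) := by
          simp only [Finset.mul_sum, ← Finset.sum_add_distrib]
          exact Finset.sum_congr rfl fun a _ => by ring
      _ = _ := by rw [h0, h1, h2]; ring
  rw [Finset.sum_sub_distrib, hmain]
  ring

theorem IsEigenExpansion.perronFrobenius_sub_isLittleO [Nonempty S] {W : Matrix S S ℝ}
    (hW : W ∈ colStochastic ℝ S)
    {u : S → S → ℝ} {α c : ℝ} {h k : S → ℝ} (E : IsEigenExpansion W u α c h k) :
    (fun θ : ℝ => perronFrobenius (Matrix.of fun a b => W a b * Real.exp (θ * u a b))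
      - (1 + α * θ + c * θ ^ 2)) =o[𝓝 0] fun θ => θ ^ 2 := by
  refine isLittleO_iff.2 fun ε hε => ?_
  -- With entries above `1/2`, an absolute error `(ε/2)θ²` is at most `εθ²` times the entry, as
  -- Collatz–Wielandt requires.
  have hv : ∀ᶠ θ : ℝ in 𝓝 0, ∀ b, 1 / 2 < 1 + θ * h b + θ ^ 2 * k b := by
    refine eventually_all.2 fun b => ?_
    have : Continuous fun θ : ℝ => 1 + θ * h b + θ ^ 2 * k b := by fun_prop
    refine (this.tendsto 0).eventually (lt_mem_nhds ?_)
    norm_num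
  have hE : ∀ᶠ θ : ℝ in 𝓝 0, ∀ b, _ :=
    eventually_all.2 fun b => isLittleO_iff.1 (E.vecMul_sub_isLittleO hW b) (half_pos hε)
  have hr : ∀ᶠ θ : ℝ in 𝓝 0, 0 < 1 + α * θ + c * θ ^ 2 - ε * θ ^ 2 := by
    have : Continuous fun θ : ℝ => 1 + α * θ + c * θ ^ 2 - ε * θ ^ 2 := by fun_prop
    refine (this.tendsto 0).eventually (lt_mem_nhds ?_)
    norm_num
  filter_upwards [hv, hE, hr] with θ hv hE hr
  rw [Real.norm_eq_abs, Real.norm_of_nonneg (sq_nonneg θ)]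
  refine abs_perronFrobenius_sub_le
    (fun a b => mul_nonneg (nonneg_of_mem_colStochastic hW) (Real.exp_nonneg _))
    (fun b => (half_pos one_pos).trans (hv b)) (by linarith) (by positivity) fun b => ?_
  have := hE b
  rw [Real.norm_eq_abs, Real.norm_of_nonneg (sq_nonneg θ)] at this
  refine this.trans ?_
  have h1 : 0 ≤ ε * θ ^ 2 := by positivity
  nlinarith [hv b]

end Expansion

/-! ### The limits defining `H^W(X|Y)` and `V^W(X|Y)` -/

section Renyi

open Asymptotics Filter Topology

variable {X Y : Type*} [Fintype X]

theorem IsNonHidden.le {W : Matrix (X × Y) (X × Y) ℝ} {WY : Matrix Y Y ℝ}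
    (hWY : IsNonHidden W WY) (hW : ∀ a b, 0 ≤ W a b) (a b : X × Y) : W a b ≤ WY a.2 b.2 := by
  rw [← hWY b.1 a.2 b.2]
  exact Finset.single_le_sum (f := fun x => W (x, a.2) b) (fun x _ => hW _ _)
    (Finset.mem_univ a.1)

/-- The conditional log-likelihood `log W(x,y|x',y') - log WY(y|y')` of one transition. -/
noncomputable def logRatio (W : Matrix (X × Y) (X × Y) ℝ) (WY : Matrix Y Y ℝ) (a b : X × Y) : ℝ :=
  Real.log (W a b) - Real.log (WY a.2 b.2)

/-- Where `W` vanishes, the default value of the logarithm is harmless: the factor `W a b` kills the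
right side, and `1 + θ > 0` kills the left. -/
theorem tilted_eq {W : Matrix (X × Y) (X × Y) ℝ} {WY : Matrix Y Y ℝ}
    (hWY : IsNonHidden W WY) (hW : ∀ a b, 0 ≤ W a b) {θ : ℝ} (hθ : -1 < θ) :
    tilted W WY θ = Matrix.of fun a b => W a b * Real.exp (θ * logRatio W WY a b) := by
  ext a b
  simp only [tilted, of_apply, logRatio]
  rcases (hW a b).eq_or_lt with h | h
  · rw [← h, Real.zero_rpow (by linarith), zero_mul, zero_mul]
  · have h' : 0 < WY a.2 b.2 := h.trans_le (hWY.le hW a b)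
    rw [Real.rpow_def_of_pos h, Real.rpow_def_of_pos h', ← Real.exp_add]
    conv_rhs => rw [← Real.exp_log h]
    rw [Real.log_exp, ← Real.exp_add]
    congr 1
    ring

variable [DecidableEq X] [Fintype Y] [DecidableEq Y]

theorem IsEigenExpansion.log_tilted_isLittleO [Nonempty (X × Y)] {W : Matrix (X × Y) (X × Y) ℝ}
    {WY : Matrix Y Y ℝ} (hW : W ∈ colStochastic ℝ (X × Y)) (hWY : IsNonHidden W WY) {α c : ℝ}
    {h k : X × Y → ℝ} (E : IsEigenExpansion W (logRatio W WY) α c h k) :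
    (fun θ => Real.log (perronFrobenius (tilted W WY θ))
      - (α * θ + (c - α ^ 2 / 2) * θ ^ 2)) =o[𝓝 0] fun θ : ℝ => θ ^ 2 := by
  refine log_sub_isLittleO_sq ((E.perronFrobenius_sub_isLittleO hW).congr' ?_ EventuallyEq.rfl)
  filter_upwards [lt_mem_nhds (show (-1 : ℝ) < 0 by norm_num)] with θ hθ
  rw [tilted_eq hWY (fun a b => nonneg_of_mem_colStochastic hW) hθ]

theorem IsEigenExpansion.tendsto_lowerRenyi [Nonempty (X × Y)] {W : Matrix (X × Y) (X × Y) ℝ}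
    {WY : Matrix Y Y ℝ} (hW : W ∈ colStochastic ℝ (X × Y)) (hWY : IsNonHidden W WY) {α c : ℝ}
    {h k : X × Y → ℝ} (E : IsEigenExpansion W (logRatio W WY) α c h k) :
    Tendsto (lowerRenyi W WY) (𝓝[≠] 0) (𝓝 (-α)) := by
  have h1 := (E.log_tilted_isLittleO hW hWY).tendsto_div_nhds_zero.mono_left
    (nhdsWithin_le_nhds (s := {0}ᶜ))
  have hid : Tendsto (fun θ : ℝ => θ) (𝓝[≠] 0) (𝓝 0) := nhdsWithin_le_nhds
  have h2 := ((h1.mul hid).add (hid.const_mul (c - α ^ 2 / 2))).const_add α |>.neg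
  simp only [mul_zero, add_zero] at h2
  refine h2.congr' ?_
  filter_upwards [self_mem_nhdsWithin] with θ hθ
  have hθ' : θ ≠ 0 := hθ
  rw [lowerRenyi]
  field_simp
  ring

theorem IsEigenExpansion.condEntropyW_eq [Nonempty (X × Y)] {W : Matrix (X × Y) (X × Y) ℝ}
    {WY : Matrix Y Y ℝ} (hW : W ∈ colStochastic ℝ (X × Y)) (hWY : IsNonHidden W WY) {α c : ℝ}
    {h k : X × Y → ℝ} (E : IsEigenExpansion W (logRatio W WY) α c h k) :
    condEntropyW W WY = -α :=
  (E.tendsto_lowerRenyi hW hWY).limUnder_eq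

theorem IsEigenExpansion.tendsto_varQuotient [Nonempty (X × Y)] {W : Matrix (X × Y) (X × Y) ℝ}
    {WY : Matrix Y Y ℝ} (hW : W ∈ colStochastic ℝ (X × Y)) (hWY : IsNonHidden W WY) {α c : ℝ}
    {h k : X × Y → ℝ} (E : IsEigenExpansion W (logRatio W WY) α c h k) :
    Tendsto (varQuotient W WY) (𝓝[≠] 0) (𝓝 (2 * c - α ^ 2)) := by
  have h1 := (E.log_tilted_isLittleO hW hWY).tendsto_div_nhds_zero.mono_left
    (nhdsWithin_le_nhds (s := {0}ᶜ))
  have h2 := (h1.const_mul 2).add_const (2 * c - α ^ 2)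
  simp only [mul_zero, zero_add] at h2
  refine h2.congr' ?_
  filter_upwards [self_mem_nhdsWithin] with θ hθ
  have hθ' : θ ≠ 0 := hθ
  rw [varQuotient, E.condEntropyW_eq hW hWY, lowerRenyi]
  field_simp
  ring

theorem IsEigenExpansion.varianceW_eq [Nonempty (X × Y)] {W : Matrix (X × Y) (X × Y) ℝ}
    {WY : Matrix Y Y ℝ} (hW : W ∈ colStochastic ℝ (X × Y)) (hWY : IsNonHidden W WY) {α c : ℝ}
    {h k : X × Y → ℝ} (E : IsEigenExpansion W (logRatio W WY) α c h k) :
    varianceW W WY = 2 * c - α ^ 2 :=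
  (E.tendsto_varQuotient hW hWY).limUnder_eq

end Renyi

open MeasureTheory ProbabilityTheory

/-! ### Variance of additive functionals of a finite Markov chain -/

section FiniteRange

variable {Ω T : Type*} [MeasurableSpace Ω] [Finite T] {μ : Measure Ω}

theorem memLp_comp_of_finite [MeasurableSpace T] [MeasurableSingletonClass T] [IsFiniteMeasure μ] {V : Ω → T} (hV : Measurable V) (ψ : T → ℝ) :
    MemLp (fun ω => ψ (V ω)) 2 μ := by
  obtain ⟨C, hC⟩ := (Set.finite_range fun t => ‖ψ t‖).bddAbove
  exact MemLp.of_bound ((measurable_of_finite ψ).comp hV).aestronglyMeasurable C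
    (ae_of_all _ fun ω => hC ⟨V ω, rfl⟩)

/-- Almost surely, a random variable of finite range takes a value of positive probability. -/
theorem ae_measureReal_preimage_ne_zero [IsFiniteMeasure μ] (V : Ω → T) :
    ∀ᵐ ω ∂μ, μ.real (V ⁻¹' {V ω}) ≠ 0 := by
  have h : ∀ t : T, ∀ᵐ ω ∂μ, V ω = t → μ.real (V ⁻¹' {V ω}) ≠ 0 := by
    intro t
    by_cases ht : μ.real (V ⁻¹' {t}) = 0
    · have h0 : μ (V ⁻¹' {t}) = 0 := (measureReal_eq_zero_iff).1 ht
      filter_upwards [measure_eq_zero_iff_ae_notMem.1 h0] with ω hω hωt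
      exact absurd hωt hω
    · exact ae_of_all _ fun ω hω => by rwa [hω]
  filter_upwards [ae_all_iff.2 h] with ω hω
  exact hω (V ω) rfl

end FiniteRange

section Chain

variable {Ω S : Type*} [MeasurableSpace Ω] [Fintype S] [MeasurableSpace S]
  [MeasurableSingletonClass S] {μ : Measure Ω} [IsProbabilityMeasure μ]
  {P : S → ℝ} {W : Matrix S S ℝ} {Z : ℕ → Ω → S}

theorem measurable_firstVars {A : Type*} [MeasurableSpace A] {V : ℕ → Ω → A}
    (hV : ∀ i, Measurable (V i)) (n : ℕ) : Measurable (firstVars V n) :=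
  measurable_pi_lambda _ fun i => hV i

theorem setOf_forall_eq_preimage_firstVars {Ω A : Type*} (V : ℕ → Ω → A) (n : ℕ) (z : Fin n → A) :
    {ω | ∀ i : Fin n, V i ω = z i} = firstVars V n ⁻¹' {z} := by
  ext ω
  simp [firstVars, funext_iff]

theorem IsMarkovChain.integral_comp_firstVars (hZ : IsMarkovChain μ P W Z) (n : ℕ)
    (ψ : (Fin (n + 1) → S) → ℝ) :
    ∫ ω, ψ (firstVars Z (n + 1) ω) ∂μ =
      ∑ z, P (z 0) * (∏ i : Fin n, W (z i.succ) (z i.castSucc)) * ψ z := by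
  have hm := measurable_firstVars hZ.measurable (n + 1)
  have := Measure.isProbabilityMeasure_map (μ := μ) hm.aemeasurable
  rw [← integral_map (f := ψ) hm.aemeasurable (measurable_of_finite ψ).aestronglyMeasurable,
    integral_fintype (Integrable.of_finite)]
  refine Finset.sum_congr rfl fun z _ => ?_
  rw [map_measureReal_apply hm (measurableSet_singleton z), ← setOf_forall_eq_preimage_firstVars,
    hZ.path_prob, smul_eq_mul]

/-- The Markov property: integrating out the last step of the chain. -/
theorem IsMarkovChain.integral_mul_step (hZ : IsMarkovChain μ P W Z) (n : ℕ)
    (ψ : (Fin (n + 1) → S) → ℝ) (u : S → S → ℝ) :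
    ∫ ω, ψ (firstVars Z (n + 1) ω) * u (Z (n + 1) ω) (Z n ω) ∂μ =
      ∫ ω, ψ (firstVars Z (n + 1) ω) * ∑ a, W a (Z n ω) * u a (Z n ω) ∂μ := by
  have h1 := hZ.integral_comp_firstVars (n + 1) fun z =>
    ψ (fun i => z i.castSucc) * u (z (Fin.last (n + 1))) (z (Fin.last n).castSucc)
  have h2 := hZ.integral_comp_firstVars n fun z =>
    ψ z * ∑ a, W a (z (Fin.last n)) * u a (z (Fin.last n))
  refine h1.trans (Eq.trans ?_ h2.symm)
  -- Split each path into its last state and the rest, so that the last transition can be summed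
  -- first.
  rw [← (Fin.snocEquiv fun _ : Fin (n + 2) => S).sum_comp, Fintype.sum_prod_type_right]
  refine Finset.sum_congr rfl fun z _ => ?_
  rw [Finset.mul_sum, Finset.mul_sum]
  refine Finset.sum_congr rfl fun a _ => ?_
  have e0 : (Fin.snocEquiv (fun _ : Fin (n + 2) => S)) (a, z) 0 = z 0 :=
    Fin.snoc_castSucc (α := fun _ : Fin (n + 2) => S) a z 0
  have e1 : ∀ i : Fin (n + 1), (Fin.snocEquiv (fun _ : Fin (n + 2) => S)) (a, z) i.castSucc = z i :=
    fun i => Fin.snoc_castSucc (α := fun _ : Fin (n + 2) => S) a z i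
  have e2 : (Fin.snocEquiv (fun _ : Fin (n + 2) => S)) (a, z) (Fin.last (n + 1)) = a :=
    Fin.snoc_last (α := fun _ : Fin (n + 2) => S) a z
  rw [Fin.prod_univ_castSucc]
  simp only [Fin.succ_castSucc, Fin.succ_last, e0, e1, e2]
  ring

theorem IsMarkovChain.integral_comp_succ (hZ : IsMarkovChain μ P W Z) (n : ℕ) (u : S → S → ℝ) :
    ∫ ω, u (Z (n + 1) ω) (Z n ω) ∂μ = ∫ ω, ∑ a, W a (Z n ω) * u a (Z n ω) ∂μ := by
  simpa using hZ.integral_mul_step n (fun _ => 1) u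

theorem IsMarkovChain.memLp_comp (hZ : IsMarkovChain μ P W Z) (n : ℕ) (g : S → ℝ) :
    MemLp (fun ω => g (Z n ω)) 2 μ :=
  memLp_comp_of_finite (hZ.measurable n) g

theorem IsMarkovChain.memLp_comp_succ (hZ : IsMarkovChain μ P W Z) (n : ℕ) (u : S → S → ℝ) :
    MemLp (fun ω => u (Z (n + 1) ω) (Z n ω)) 2 μ :=
  memLp_comp_of_finite ((hZ.measurable (n + 1)).prodMk (hZ.measurable n)) fun p => u p.1 p.2

theorem IsMarkovChain.memLp_sum (hZ : IsMarkovChain μ P W Z) (m : ℕ) (u : S → S → ℝ) :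
    MemLp (fun ω => ∑ i ∈ Finset.range m, u (Z (i + 1) ω) (Z i ω)) 2 μ :=
  memLp_finsetSum _ fun i _ => hZ.memLp_comp_succ i u

variable {D : S → S → ℝ}

theorem IsMarkovChain.integral_sum_eq_zero (hZ : IsMarkovChain μ P W Z)
    (hD : ∀ b, ∑ a, W a b * D a b = 0) (m : ℕ) :
    ∫ ω, ∑ i ∈ Finset.range m, D (Z (i + 1) ω) (Z i ω) ∂μ = 0 := by
  rw [integral_finsetSum _ fun i _ => (hZ.memLp_comp_succ i D).integrable one_le_two]
  refine Finset.sum_eq_zero fun i _ => ?_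
  simp [hZ.integral_comp_succ i D, hD]

/-- Martingale increments are orthogonal by the Markov property, so only the squares contribute; in
them the coboundary of `k` telescopes. -/
theorem IsMarkovChain.integral_sum_sq (hZ : IsMarkovChain μ P W Z)
    (hD : ∀ b, ∑ a, W a b * D a b = 0) {v : ℝ} {k : S → ℝ}
    (hv : ∀ b, ∑ a, W a b * D a b ^ 2 = v + k b - (k ᵥ* W) b) (m : ℕ) :
    ∫ ω, (∑ i ∈ Finset.range m, D (Z (i + 1) ω) (Z i ω)) ^ 2 ∂μ =
      m * v + ∫ ω, k (Z 0 ω) ∂μ - ∫ ω, k (Z m ω) ∂μ := by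
  induction m with
  | zero => simp
  | succ m ih =>
    have hM := hZ.memLp_sum m D
    have hDm := hZ.memLp_comp_succ m D
    have hcross : ∫ ω, (∑ i ∈ Finset.range m, D (Z (i + 1) ω) (Z i ω)) *
        D (Z (m + 1) ω) (Z m ω) ∂μ = 0 := by
      have h := hZ.integral_mul_step m
        (fun z => ∑ i : Fin m, D (z i.succ) (z i.castSucc)) D
      simp only [hD, mul_zero, integral_zero] at h
      rw [← h]
      refine integral_congr_ae (ae_of_all _ fun ω => ?_)
      simp only [firstVars, Fin.val_succ, Fin.val_castSucc]
      rw [Finset.sum_range fun i => D (Z (i + 1) ω) (Z i ω)]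
    have hk : ∀ j, Integrable (fun ω => k (Z j ω)) μ := fun j =>
      (hZ.memLp_comp j k).integrable one_le_two
    have hstep : ∫ ω, D (Z (m + 1) ω) (Z m ω) ^ 2 ∂μ =
        v + ∫ ω, k (Z m ω) ∂μ - ∫ ω, k (Z (m + 1) ω) ∂μ := by
      have h1 := hZ.integral_comp_succ m fun a b => D a b ^ 2
      have h2 := hZ.integral_comp_succ m fun a _ => k a
      have h3 : Integrable (fun ω => (k ᵥ* W) (Z m ω)) μ :=
        (hZ.memLp_comp m _).integrable one_le_two
      have e : (fun ω => ∑ a, W a (Z m ω) * k a) = fun ω => (k ᵥ* W) (Z m ω) := by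
        funext ω
        simp [vecMul, dotProduct, mul_comm]
      simp only [hv] at h1
      have h4 : Integrable (fun ω => v + k (Z m ω)) μ := (integrable_const v).add (hk m)
      rw [h1, h2, e, integral_sub h4 h3,
        integral_add (integrable_const v) (hk m)]
      simp
    have hexp : ∀ ω, (∑ i ∈ Finset.range (m + 1), D (Z (i + 1) ω) (Z i ω)) ^ 2 =
        (∑ i ∈ Finset.range m, D (Z (i + 1) ω) (Z i ω)) ^ 2 +
        2 * ((∑ i ∈ Finset.range m, D (Z (i + 1) ω) (Z i ω)) * D (Z (m + 1) ω) (Z m ω)) +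
        D (Z (m + 1) ω) (Z m ω) ^ 2 := by
      intro ω
      rw [Finset.sum_range_succ]
      ring
    simp_rw [hexp]
    have hcrossI : Integrable (fun ω => 2 * ((∑ i ∈ Finset.range m, D (Z (i + 1) ω) (Z i ω)) *
        D (Z (m + 1) ω) (Z m ω))) μ := (hM.integrable_mul hDm).const_mul 2
    have hI : Integrable (fun ω => (∑ i ∈ Finset.range m, D (Z (i + 1) ω) (Z i ω)) ^ 2 +
        2 * ((∑ i ∈ Finset.range m, D (Z (i + 1) ω) (Z i ω)) * D (Z (m + 1) ω) (Z m ω))) μ :=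
      hM.integrable_sq.add hcrossI
    rw [integral_add hI hDm.integrable_sq,
      integral_add hM.integrable_sq hcrossI, integral_const_mul, hcross, ih, hstep]
    push_cast
    ring

theorem IsMarkovChain.exists_abs_variance_sum_sub_le (hZ : IsMarkovChain μ P W Z)
    (hD : ∀ b, ∑ a, W a b * D a b = 0) {v : ℝ} {k : S → ℝ}
    (hv : ∀ b, ∑ a, W a b * D a b ^ 2 = v + k b - (k ᵥ* W) b) :
    ∃ C, ∀ m : ℕ,
      |Var[fun ω => ∑ i ∈ Finset.range m, D (Z (i + 1) ω) (Z i ω); μ] - m * v| ≤ C := by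
  obtain ⟨C, hC⟩ := (Set.finite_range fun s => ‖k s‖).bddAbove
  have hb : ∀ j, |∫ ω, k (Z j ω) ∂μ| ≤ C := fun j => by
    have := norm_integral_le_of_norm_le_const (μ := μ) (f := fun ω => k (Z j ω)) (C := C)
      (ae_of_all _ fun ω => hC ⟨Z j ω, rfl⟩)
    simpa using this
  refine ⟨C + C, fun m => ?_⟩
  rw [variance_of_integral_eq_zero (hZ.memLp_sum m D).aestronglyMeasurable.aemeasurable
    (hZ.integral_sum_eq_zero hD m), hZ.integral_sum_sq hD hv m]
  calc |m * v + ∫ ω, k (Z 0 ω) ∂μ - ∫ ω, k (Z m ω) ∂μ - m * v|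
      = |∫ ω, k (Z 0 ω) ∂μ - ∫ ω, k (Z m ω) ∂μ| := by congr 1; ring
    _ ≤ C + C := (abs_sub _ _).trans (add_le_add (hb 0) (hb m))

end Chain

/-! ### Stability of linear variance growth under terms of bounded variance -/

section Perturbation

variable {Ω : Type*} [MeasurableSpace Ω] {μ : Measure Ω}

/-- Nonnegativity of `Var[tR - M]` at `t = ±s` bounds the covariance. The parameter `s` is free; `s
= √(m+1)` balances a bounded `Var[R]` against a linearly growing `Var[M]`. -/
theorem abs_variance_sub_sub_le [IsFiniteMeasure μ] {R M : Ω → ℝ} (hR : MemLp R 2 μ)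
    (hM : MemLp M 2 μ) {s : ℝ} (hs : 0 < s) :
    |Var[fun ω => R ω - M ω; μ] - Var[M; μ]| ≤ Var[R; μ] + s * Var[R; μ] + Var[M; μ] / s := by
  have h1 : ∀ t : ℝ, 0 ≤ t ^ 2 * Var[R; μ] - 2 * (t * cov[R, M; μ]) + Var[M; μ] := by
    intro t
    have := variance_nonneg (fun ω => t * R ω - M ω) μ
    rwa [variance_fun_sub (hR.const_mul t) hM, variance_const_mul, covariance_const_mul_left]
      at this
  have h2 := h1 s
  have h3 := h1 (-s)
  have hR0 := variance_nonneg R μ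
  rw [variance_fun_sub hR hM]
  have key : |2 * cov[R, M; μ]| ≤ s * Var[R; μ] + Var[M; μ] / s := by
    have e : s * Var[R; μ] + Var[M; μ] / s = (s ^ 2 * Var[R; μ] + Var[M; μ]) / s := by
      field_simp
    rw [e, le_div_iff₀ hs, ← abs_of_pos hs, ← abs_mul, abs_of_pos hs, abs_le]
    constructor <;> linarith
  rw [abs_le] at key ⊢
  constructor <;> linarith [key.1, key.2]

open Filter Topology in
theorem tendsto_variance_sub_div [IsFiniteMeasure μ] {R M : ℕ → Ω → ℝ}
    (hR : ∀ m, MemLp (R m) 2 μ)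
    (hM : ∀ m, MemLp (M m) 2 μ) {K C v : ℝ} (hK : ∀ m, Var[R m; μ] ≤ K)
    (hC : ∀ m : ℕ, |Var[M m; μ] - m * v| ≤ C) :
    Tendsto (fun m : ℕ => 1 / ((m : ℝ) + 1) * Var[fun ω => R m ω - M m ω; μ]) atTop (𝓝 v) := by
  obtain ⟨B, hB⟩ : ∃ B, B = K + C + |v| := ⟨_, rfl⟩
  have hC0 : 0 ≤ C := (abs_nonneg _).trans (hC 0)
  have hbound : ∀ m : ℕ, |1 / ((m : ℝ) + 1) * Var[fun ω => R m ω - M m ω; μ] - v| ≤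
      B * (1 / ((m : ℝ) + 1)) + B * (1 / √((m : ℝ) + 1)) := by
    intro m
    have hm : (0 : ℝ) < (m : ℝ) + 1 := by positivity
    have hs : 0 < √((m : ℝ) + 1) := Real.sqrt_pos.2 hm
    have hss : √((m : ℝ) + 1) * √((m : ℝ) + 1) = (m : ℝ) + 1 := Real.mul_self_sqrt hm.le
    have h1 := abs_variance_sub_sub_le (hR m) (hM m) hs
    have hMle : Var[M m; μ] ≤ (C + |v|) * ((m : ℝ) + 1) := by
      have := (abs_le.1 (hC m)).2
      have h3 : (m : ℝ) * v ≤ m * |v| := mul_le_mul_of_nonneg_left (le_abs_self v) (by positivity)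
      have h4 : 0 ≤ C * m := by positivity
      have h5 := abs_nonneg v
      linarith
    have hMs : Var[M m; μ] / √((m : ℝ) + 1) ≤ (C + |v|) * √((m : ℝ) + 1) := by
      rw [div_le_iff₀ hs, mul_assoc, hss]
      exact hMle
    have hKs : √((m : ℝ) + 1) * Var[R m; μ] ≤ K * √((m : ℝ) + 1) := by
      rw [mul_comm]
      exact mul_le_mul_of_nonneg_right (hK m) hs.le
    have htot : |Var[fun ω => R m ω - M m ω; μ] - ((m : ℝ) + 1) * v| ≤
        B + B * √((m : ℝ) + 1) := by
      have e : Var[fun ω => R m ω - M m ω; μ] - ((m : ℝ) + 1) * v =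
          (Var[fun ω => R m ω - M m ω; μ] - Var[M m; μ]) + (Var[M m; μ] - m * v) - v := by ring
      rw [e]
      refine (abs_sub _ _).trans ((add_le_add_left (abs_add_le _ _) _).trans ?_)
      have := hC m
      have := hK m
      rw [hB]
      linarith
    have e : 1 / ((m : ℝ) + 1) * Var[fun ω => R m ω - M m ω; μ] - v =
        (Var[fun ω => R m ω - M m ω; μ] - ((m : ℝ) + 1) * v) / ((m : ℝ) + 1) := by
      field_simp
    rw [e, abs_div, abs_of_pos hm, div_le_iff₀ hm]
    refine htot.trans_eq ?_
    have e2 : 1 / √((m : ℝ) + 1) * ((m : ℝ) + 1) = √((m : ℝ) + 1) := by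
      rw [one_div, inv_mul_eq_iff_eq_mul₀ hs.ne', hss]
    rw [add_mul, mul_assoc, mul_assoc, e2, one_div_mul_cancel hm.ne', mul_one]
  have h0 : Tendsto (fun m : ℕ => B * (1 / ((m : ℝ) + 1)) + B * (1 / √((m : ℝ) + 1))) atTop
      (𝓝 0) := by
    have h1 : Tendsto (fun m : ℕ => (m : ℝ) + 1) atTop atTop :=
      tendsto_atTop_add_const_right _ _ tendsto_natCast_atTop_atTop
    have h2 := (tendsto_const_nhds (x := (1 : ℝ))).div_atTop h1
    have h3 := (tendsto_const_nhds (x := (1 : ℝ))).div_atTop (Real.tendsto_sqrt_atTop.comp h1)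
    simpa using (h2.const_mul B).add (h3.const_mul B)
  rw [tendsto_iff_norm_sub_tendsto_zero]
  exact squeeze_zero (fun _ => norm_nonneg _) hbound h0

end Perturbation

/-! ### The conditional log-likelihood of a non-hidden chain -/

section NonHidden

theorem IsMarkovChain.measureReal_inter {X Y Ω : Type*} [MeasurableSpace X]
    [MeasurableSpace Y] [MeasurableSpace Ω] {μ : Measure Ω} {P : X × Y → ℝ}
    {W : Matrix (X × Y) (X × Y) ℝ} {U : ℕ → Ω → X} {V : ℕ → Ω → Y}
    (hZ : IsMarkovChain μ P W fun i ω => (U i ω, V i ω)) (n : ℕ) (x : Fin (n + 1) → X) (y : Fin (n + 1) → Y) :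
    μ.real (firstVars V (n + 1) ⁻¹' {y} ∩ firstVars U (n + 1) ⁻¹' {x}) =
      P (x 0, y 0) * ∏ i : Fin n, W (x i.succ, y i.succ) (x i.castSucc, y i.castSucc) := by
  rw [← hZ.path_prob n fun i => (x i, y i)]
  congr 1
  ext ω
  simp [firstVars, funext_iff, forall_and, and_comm]

variable {X Y : Type*} [Fintype X]

/-- Summing the path probabilities over the hidden component. -/
theorem IsNonHidden.sum_path {W : Matrix (X × Y) (X × Y) ℝ} {WY : Matrix Y Y ℝ}
    (hWY : IsNonHidden W WY) (P : X × Y → ℝ) (n : ℕ) (y : Fin (n + 1) → Y) :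
    ∑ x : Fin (n + 1) → X, P (x 0, y 0) *
        ∏ i : Fin n, W (x i.succ, y i.succ) (x i.castSucc, y i.castSucc) =
      (∑ x, P (x, y 0)) * ∏ i : Fin n, WY (y i.succ) (y i.castSucc) := by
  induction n with
  | zero =>
    simp only [Finset.univ_eq_empty, Finset.prod_empty, mul_one]
    exact (Equiv.funUnique (Fin 1) X).sum_comp fun x => P (x, y 0)
  | succ n ih =>
    have ih' := ih fun i => y i.castSucc
    rw [Fin.prod_univ_castSucc]
    simp only [Fin.castSucc_zero] at ih'
    simp only [Fin.succ_castSucc, Fin.succ_last]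
    rw [← mul_assoc, ← ih', Finset.sum_mul,
      ← (Fin.snocEquiv fun _ : Fin (n + 2) => X).sum_comp, Fintype.sum_prod_type_right]
    refine Finset.sum_congr rfl fun z _ => ?_
    -- Non-hiddenness enters here: the last factor `WY` may be expanded using whichever previous
    -- state the path has.
    rw [← hWY (z (Fin.last n)), Finset.mul_sum]
    refine Finset.sum_congr rfl fun a _ => ?_
    have e0 : (Fin.snocEquiv (fun _ : Fin (n + 2) => X)) (a, z) 0 = z 0 :=
      Fin.snoc_castSucc (α := fun _ : Fin (n + 2) => X) a z 0
    have e1 : ∀ i : Fin (n + 1),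
        (Fin.snocEquiv (fun _ : Fin (n + 2) => X)) (a, z) i.castSucc = z i :=
      fun i => Fin.snoc_castSucc (α := fun _ : Fin (n + 2) => X) a z i
    have e2 : (Fin.snocEquiv (fun _ : Fin (n + 2) => X)) (a, z) (Fin.last (n + 1)) = a :=
      Fin.snoc_last (α := fun _ : Fin (n + 2) => X) a z
    rw [Fin.prod_univ_castSucc]
    simp only [Fin.succ_castSucc, Fin.succ_last, e0, e1, e2]
    ring

variable [MeasurableSpace X] [MeasurableSingletonClass X] [MeasurableSpace Y]
  [MeasurableSingletonClass Y] {Ω : Type*} [MeasurableSpace Ω] {μ : Measure Ω}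
  [IsProbabilityMeasure μ] {P : X × Y → ℝ} {W : Matrix (X × Y) (X × Y) ℝ} {WY : Matrix Y Y ℝ}
  {U : ℕ → Ω → X} {V : ℕ → Ω → Y}

theorem IsMarkovChain.measureReal_snd (hZ : IsMarkovChain μ P W fun i ω => (U i ω, V i ω))
    (hWY : IsNonHidden W WY) (n : ℕ) (y : Fin (n + 1) → Y) :
    μ.real (firstVars V (n + 1) ⁻¹' {y}) =
      (∑ x, P (x, y 0)) * ∏ i : Fin n, WY (y i.succ) (y i.castSucc) := by
  classical
  have hU := measurable_firstVars (fun i => (hZ.measurable i).fst) (n + 1)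
  have hV := measurable_firstVars (fun i => (hZ.measurable i).snd) (n + 1)
  rw [← hWY.sum_path]
  simp_rw [← hZ.measureReal_inter]
  rw [← measureReal_iUnion_fintype]
  · rw [← Set.inter_iUnion, ← Set.preimage_iUnion, Set.iUnion_of_singleton, Set.preimage_univ,
      Set.inter_univ]
  · intro x x' hx
    refine Set.disjoint_left.2 fun ω h h' => hx ?_
    exact h.2.symm.trans h'.2
  · exact fun x => (hV (measurableSet_singleton y)).inter (hU (measurableSet_singleton x))

/-- Almost surely, the conditional log-likelihood of a path is an additive functional of it. -/
theorem IsMarkovChain.ae_log_condProb [Fintype Y]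
    (hZ : IsMarkovChain μ P W fun i ω => (U i ω, V i ω)) (hWY : IsNonHidden W WY) (n : ℕ) :
    ∀ᵐ ω ∂μ, Real.log (1 / condProb μ (firstVars U (n + 1)) (firstVars V (n + 1))
        (firstVars U (n + 1) ω) (firstVars V (n + 1) ω)) =
      Real.log (∑ x, P (x, V 0 ω)) - Real.log (P (U 0 ω, V 0 ω)) -
        ∑ i ∈ Finset.range n,
          logRatio W WY (U (i + 1) ω, V (i + 1) ω) (U i ω, V i ω) := by
  have hV := measurable_firstVars (fun i => (hZ.measurable i).snd) (n + 1)
  -- Off a null set the joint and marginal path probabilities are nonzero, hence so is every factor,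
  -- and the logarithms split into sums.
  filter_upwards [ae_measureReal_preimage_ne_zero (μ := μ)
      (fun ω => (firstVars U (n + 1) ω, firstVars V (n + 1) ω)),
    ae_measureReal_preimage_ne_zero (μ := μ) (firstVars V (n + 1))] with ω h1 h2
  have h1' : μ.real (firstVars V (n + 1) ⁻¹' {firstVars V (n + 1) ω} ∩
      firstVars U (n + 1) ⁻¹' {firstVars U (n + 1) ω}) ≠ 0 := by
    convert h1 using 2
    ext ω'
    simp [and_comm]
  have hc : condProb μ (firstVars U (n + 1)) (firstVars V (n + 1))
        (firstVars U (n + 1) ω) (firstVars V (n + 1) ω) =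
      (μ.real (firstVars V (n + 1) ⁻¹' {firstVars V (n + 1) ω}))⁻¹ *
        μ.real (firstVars V (n + 1) ⁻¹' {firstVars V (n + 1) ω} ∩
          firstVars U (n + 1) ⁻¹' {firstVars U (n + 1) ω}) := by
    rw [condProb, measureReal_def, cond_apply (hV (measurableSet_singleton _)),
      ENNReal.toReal_mul, ENNReal.toReal_inv]
    rfl
  rw [hc, one_div, Real.log_inv, Real.log_mul (inv_ne_zero h2) h1', Real.log_inv]
  rw [hZ.measureReal_inter] at h1' ⊢
  rw [hZ.measureReal_snd hWY] at h2 ⊢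
  obtain ⟨hP, hWp⟩ := mul_ne_zero_iff.1 h1'
  obtain ⟨hPY, hWYp⟩ := mul_ne_zero_iff.1 h2
  rw [Real.log_mul hP hWp, Real.log_mul hPY hWYp, Real.log_prod (Finset.prod_ne_zero_iff.1 hWp),
    Real.log_prod (Finset.prod_ne_zero_iff.1 hWYp), Finset.sum_range]
  simp only [logRatio, Finset.sum_sub_distrib, firstVars, Fin.val_zero, Fin.val_succ,
    Fin.val_castSucc]
  ring

end NonHidden

/-! ### The asymptotic variance -/

section Asymptotic

open Filter Topology

variable {S : Type*} [Fintype S] [DecidableEq S] {W : Matrix S S ℝ} {u : S → S → ℝ} {α c : ℝ}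
  {h k : S → ℝ}

/-- The martingale difference attached to the additive functional `u`. -/
def martingaleDiff (u : S → S → ℝ) (α : ℝ) (h : S → ℝ) (a b : S) : ℝ :=
  u a b - α + h a - h b

theorem IsEigenExpansion.sum_martingaleDiff (E : IsEigenExpansion W u α c h k)
    (hW : W ∈ colStochastic ℝ S) (b : S) : ∑ a, W a b * martingaleDiff u α h a b = 0 := by
  have h0 : ∑ a, W a b = 1 := sum_col_of_mem_colStochastic hW b
  have h1 := E.first b
  simp only [vecMul, dotProduct] at h1
  calc _ = ∑ a, W a b * u a b + ∑ a, h a * W a b - (α + h b) * ∑ a, W a b := by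
        simp only [Finset.mul_sum, ← Finset.sum_add_distrib, ← Finset.sum_sub_distrib]
        exact Finset.sum_congr rfl fun a _ => by rw [martingaleDiff]; ring
    _ = 0 := by rw [h0, h1]; ring

/-- Here the spectral and probabilistic constants meet: after expanding the square, the second
Poisson equation supplies exactly the terms in `u²` and `u h`. -/
theorem IsEigenExpansion.sum_martingaleDiff_sq (E : IsEigenExpansion W u α c h k)
    (hW : W ∈ colStochastic ℝ S) (b : S) :
    ∑ a, W a b * martingaleDiff u α h a b ^ 2 = (2 * c - α ^ 2) +
      (fun s => 2 * k s - h s ^ 2) b - ((fun s => 2 * k s - h s ^ 2) ᵥ* W) b := by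
  have h0 : ∑ a, W a b = 1 := sum_col_of_mem_colStochastic hW b
  have h1 := E.first b
  have h2 := E.second b
  simp only [vecMul, dotProduct] at h1 h2 ⊢
  calc _ = 2 * ∑ a, W a b * (u a b ^ 2 / 2 + u a b * h a) + ∑ a, h a ^ 2 * W a b
        - 2 * (α + h b) * (∑ a, W a b * u a b + ∑ a, h a * W a b)
        + (α + h b) ^ 2 * ∑ a, W a b := by
        simp only [Finset.mul_sum, ← Finset.sum_add_distrib, ← Finset.sum_sub_distrib]
        exact Finset.sum_congr rfl fun a _ => by rw [martingaleDiff]; ring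
    _ = (2 * c - α ^ 2) + (2 * k b - h b ^ 2)
        - (2 * ∑ a, k a * W a b - ∑ a, h a ^ 2 * W a b) := by rw [h0, h1, h2]; ring
    _ = _ := by
        rw [Finset.mul_sum, ← Finset.sum_sub_distrib]
        congr 1
        exact Finset.sum_congr rfl fun a _ => by ring

theorem IsEigenExpansion.tendsto_variance (E : IsEigenExpansion W u α c h k)
    (hW : W ∈ colStochastic ℝ S) [MeasurableSpace S] [MeasurableSingletonClass S]
    {Ω : Type*} [MeasurableSpace Ω] {μ : Measure Ω} [IsProbabilityMeasure μ] {P : S → ℝ}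
    {Z : ℕ → Ω → S} (hZ : IsMarkovChain μ P W Z) (r : S → ℝ) :
    Tendsto (fun m : ℕ => 1 / ((m : ℝ) + 1) *
        Var[fun ω => r (Z 0 ω) - ∑ i ∈ Finset.range m, u (Z (i + 1) ω) (Z i ω); μ])
      atTop (𝓝 (2 * c - α ^ 2)) := by
  obtain ⟨C, hC⟩ := hZ.exists_abs_variance_sum_sub_le (E.sum_martingaleDiff hW)
    (E.sum_martingaleDiff_sq hW)
  -- The initial term together with the telescoped coboundary of `h`; it takes finitely many values,
  -- so its variance is bounded uniformly in `m`.
  let R : ℕ → Ω → ℝ := fun m ω => r (Z 0 ω) - h (Z 0 ω) + h (Z m ω)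
  have hR : ∀ m, MemLp (R m) 2 μ := fun m =>
    ((hZ.memLp_comp 0 r).sub (hZ.memLp_comp 0 h)).add (hZ.memLp_comp m h)
  obtain ⟨K, hK⟩ := (Set.finite_range fun p : S × S => |r p.1 - h p.1 + h p.2|).bddAbove
  have hRvar : ∀ m, Var[R m; μ] ≤ ((K - -K) / 2) ^ 2 := fun m =>
    variance_le_sq_of_bounded
      (ae_of_all _ fun ω => abs_le.1 (hK ⟨(Z 0 ω, Z m ω), rfl⟩))
      (hR m).aestronglyMeasurable.aemeasurable
  refine (tendsto_variance_sub_div hR (fun m => hZ.memLp_sum m (martingaleDiff u α h)) hRvar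
    hC).congr fun m => ?_
  congr 1
  -- The centring `mα` is deterministic and does not affect the variance.
  refine (variance_const_add ((hR m).sub
    (hZ.memLp_sum m (martingaleDiff u α h))).aestronglyMeasurable (-(m * α))).symm.trans ?_
  congr 1
  funext ω
  have htel := Finset.sum_range_sub (fun i => h (Z i ω)) m
  have hsum : ∑ i ∈ Finset.range m, martingaleDiff u α h (Z (i + 1) ω) (Z i ω) =
      ∑ i ∈ Finset.range m, u (Z (i + 1) ω) (Z i ω) - m * α + (h (Z m ω) - h (Z 0 ω)) := by
    rw [← htel]
    simp only [martingaleDiff, Finset.sum_add_distrib, Finset.sum_sub_distrib, Finset.sum_const,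
      Finset.card_range, nsmul_eq_mul]
    ring
  simp only [R, Pi.sub_apply, hsum]
  ring

end Asymptotic

end MarkovVariance

/-- The first two conjuncts say that the limits defining `H^W(X|Y)` and `V^W(X|Y)` exist. -/
theorem mainTheorem2
    {𝒳 𝒴 : Type*} [Fintype 𝒳] [DecidableEq 𝒳] [Fintype 𝒴] [DecidableEq 𝒴]
    [MeasurableSpace 𝒳] [MeasurableSingletonClass 𝒳]
    [MeasurableSpace 𝒴] [MeasurableSingletonClass 𝒴]
    (W : Matrix (𝒳 × 𝒴) (𝒳 × 𝒴) ℝ) (hW : W ∈ Matrix.colStochastic ℝ (𝒳 × 𝒴))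
    (hirr : W.IsIrreducible)
    (WY : Matrix 𝒴 𝒴 ℝ) (hWY : MarkovVariance.IsNonHidden W WY)
    (P : 𝒳 × 𝒴 → ℝ) (hP : P ∈ stdSimplex ℝ (𝒳 × 𝒴))
    {Ω : Type*} [MeasurableSpace Ω] (μ : MeasureTheory.Measure Ω)
    [MeasureTheory.IsProbabilityMeasure μ]
    (X : ℕ → Ω → 𝒳) (Y : ℕ → Ω → 𝒴)
    (hXY : MarkovVariance.IsMarkovChain μ P W (fun i ω => (X i ω, Y i ω))) :
    Filter.Tendsto (MarkovVariance.lowerRenyi W WY) (nhdsWithin (0 : ℝ) {0}ᶜ)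
        (nhds (MarkovVariance.condEntropyW W WY)) ∧
      Filter.Tendsto (MarkovVariance.varQuotient W WY) (nhdsWithin (0 : ℝ) {0}ᶜ)
        (nhds (MarkovVariance.varianceW W WY)) ∧
      Filter.Tendsto
        (fun n : ℕ => (1 / (n : ℝ)) *
          MarkovVariance.condVar μ (MarkovVariance.firstVars X n) (MarkovVariance.firstVars Y n))
        Filter.atTop (nhds (MarkovVariance.varianceW W WY)) := by
  have hne : Nonempty (𝒳 × 𝒴) := by
    by_contra hemp
    rw [not_nonempty_iff] at hemp
    simpa using hP.2
  obtain ⟨α, c, h, k, E⟩ := MarkovVariance.exists_isEigenExpansion hW hirr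
    (MarkovVariance.logRatio W WY)
  rw [E.varianceW_eq hW hWY, E.condEntropyW_eq hW hWY]
  refine ⟨E.tendsto_lowerRenyi hW hWY, E.tendsto_varQuotient hW hWY, ?_⟩
  -- A path of `m + 1` states has `m` transitions; the shift also discards `n = 0`.
  rw [← Filter.tendsto_add_atTop_iff_nat 1]
  refine (E.tendsto_variance hW hXY fun s =>
    Real.log (∑ x, P (x, s.2)) - Real.log (P s)).congr fun m => ?_
  rw [MarkovVariance.condVar, ProbabilityTheory.variance_congr (hXY.ae_log_condProb hWY m)]
  push_cast
  rfl
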